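/- Let $A$ be an element of $\mathrm{SL}(n,\mathbb{C})$ that is reversible, i.e. $hAh^{-1}=A^{-1}$ for some $h\in\mathrm{SL}(n,\mathbb{C})$. Let $p\ge 0$ (resp. $q\ge 0$) be the algebraic multiplicity of $+1$ (resp. $-1$) as an eigenvalue of $A$, and let $\mathbf{d}(p)$ (resp. $\mathbf{d}(q)$) be the partition of $p$ (resp. $q$) formed by the sizes of the Jordan blocks with eigenvalue $+1$ (resp. $-1$) in a Jordan decomposition of $A$. For a partition $\mathbf{d}=[d_1^{t_1},\dots,d_s^{t_s}]$ with distinct parts $d_1>\dots>d_s>0$ and multiplicities $t_i\ge 1$, let $\mathbb{O}_{\mathbf{d}}$ be the set of its odd parts, and let $$|\mathbb{E}^2_{\mathbf{d}}| := \sum_{i\,:\,d_i\equiv 2\ (\mathrm{mod}\ 4)} t_i$$ be the number of its parts that are congruent to $2$ modulo $4$, counted with multiplicity. Then $A$ is strongly reversible in $\mathrm{SL}(n,\mathbb{C})$, i.e. $A=ab$ with $a,b\in\mathrm{SL}(n,\mathbb{C})$ and $a^2=b^2=I_n$, if and only if at least one of the following conditions holds: 1. $\mathbb{O}_{\mathbf{d}(p)}$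 or $\mathbb{O}_{\mathbf{d}(q)}$ is non-empty; 2. $|\mathbb{E}^2_{\mathbf{d}(p)}|+|\mathbb{E}^2_{\mathbf{d}(q)}|+\dfrac{n-(p+q)}{2}$ is an even integer. -/

import Mathlib

namespace StrongReversibility

/-! ### Reversible and strongly reversible elements of a group -/

/-- `g` is reversible in the group `G`: it is conjugate to its inverse by an element of `G`. -/
def IsReversible {G : Type*} [Group G] (g : G) : Prop :=
  ∃ h : G, h * g * h⁻¹ = g⁻¹

/-- `g` is an involution: `g ^ 2 = e` (the identity element is allowed). -/
def IsInvolution {G : Type*} [Group G] (g : G) : Prop :=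
  g ^ 2 = 1

/-- `g` is strongly reversible in the group `G`: it is a product of two involutions of `G`. -/
def IsStronglyReversible {G : Type*} [Group G] (g : G) : Prop :=
  ∃ a b : G, IsInvolution a ∧ IsInvolution b ∧ g = a * b

/-! ### Jordan decompositions -/

/-- The Jordan block `J(μ, m)`: `μ` on the diagonal, `1` on the super-diagonal, `0` elsewhere. -/
def jordanBlock (μ : ℂ) (m : ℕ) : Matrix (Fin m) (Fin m) ℂ :=
  Matrix.of fun i j => if i = j then μ else if (i : ℕ) + 1 = (j : ℕ) then 1 else 0

/-- The direct sum of the Jordan blocks `J(ev i, sz i)`. -/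
def jordanMatrix {k : ℕ} (ev : Fin k → ℂ) (sz : Fin k → ℕ) :
    Matrix (Σ i, Fin (sz i)) (Σ i, Fin (sz i)) ℂ :=
  Matrix.blockDiagonal' fun i => jordanBlock (ev i) (sz i)

/-- A Jordan decomposition of the complex `n × n` matrix `A`: finitely many Jordan blocks
`J(ev i, sz i)` of positive size and an invertible `S` such that `S A S⁻¹` is their direct sum.
The bijection `index` lays the rows and columns of the blocks out as `0, …, n - 1`. -/
structure JordanDecomposition {n : ℕ} (A : Matrix (Fin n) (Fin n) ℂ) where
  /-- the number of blocks -/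
  k : ℕ
  /-- the eigenvalues of the blocks -/
  ev : Fin k → ℂ
  /-- the sizes of the blocks -/
  sz : Fin k → ℕ
  sz_pos : ∀ i, 0 < sz i
  /-- the positions of the basis vectors of the blocks -/
  index : (Σ i, Fin (sz i)) ≃ Fin n
  /-- the conjugating matrix -/
  S : Matrix.GeneralLinearGroup (Fin n) ℂ
  conj_eq : (S : Matrix (Fin n) (Fin n) ℂ) * A * (S : Matrix (Fin n) (Fin n) ℂ)⁻¹
    = Matrix.reindex index index (jordanMatrix ev sz)

/-- The (algebraic) multiplicity of `μ` as an eigenvalue of `A` (`0` if it is not one). -/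
noncomputable def eigenMult {n : ℕ} (A : Matrix (Fin n) (Fin n) ℂ) (μ : ℂ) : ℕ :=
  A.charpoly.rootMultiplicity μ

lemma jordanMatrix_diag {k : ℕ} (ev : Fin k → ℂ) (sz : Fin k → ℕ) (x : Σ i, Fin (sz i)) :
    jordanMatrix ev sz x x = ev x.1 := by
  simp [jordanMatrix, jordanBlock, Matrix.blockDiagonal'_apply]

lemma jordanMatrix_charpoly {k : ℕ} (ev : Fin k → ℂ) (sz : Fin k → ℕ) :
    (jordanMatrix ev sz).charpoly = ∏ i, (Polynomial.X - Polynomial.C (ev i)) ^ sz i := by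
  let e : (Σ i, Fin (sz i)) ≃ Σₗ i, Fin (sz i) := toLex
  have htri : (Matrix.reindex e e (jordanMatrix ev sz)).IsUpperTriangular := by
    intro x y h
    obtain ⟨⟨i, a⟩, rfl⟩ := e.surjective x
    obtain ⟨⟨j, b⟩, rfl⟩ := e.surjective y
    have h' : Sigma.Lex (· < ·) (fun _ => (· < ·)) (⟨j, b⟩ : Σ i, Fin (sz i)) ⟨i, a⟩ := h
    rw [Sigma.lex_iff] at h'
    rw [Matrix.reindex_apply, Matrix.submatrix_apply, Equiv.symm_apply_apply,
      Equiv.symm_apply_apply, jordanMatrix, Matrix.blockDiagonal'_apply]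
    split_ifs with hij
    · dsimp at hij
      subst hij
      rcases h' with h' | ⟨_, h'⟩
      · exact absurd h' (lt_irrefl _)
      · have h0 : b < a := h'
        have h1 : a ≠ b := ne_of_gt h0
        have h2 : ¬ ((a : ℕ) + 1 = b) := by
          have := Fin.lt_def.1 h0
          omega
        simp [jordanBlock, h1, h2]
    · rfl
  have hdet : (jordanMatrix ev sz).charpoly =
      ∏ x : Σ i, Fin (sz i), (Polynomial.X - Polynomial.C (ev x.1)) := by
    rw [← Matrix.charpoly_reindex e, Matrix.charpoly, Matrix.det_of_isUpperTriangular
      (Matrix.charmatrix_blockTriangular_iff.2 htri), ← e.prod_comp]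
    refine Finset.prod_congr rfl fun x _ => ?_
    rw [Matrix.charmatrix_apply_eq, Matrix.reindex_apply, Matrix.submatrix_apply,
      Equiv.symm_apply_apply, jordanMatrix_diag]
  rw [hdet, Fintype.prod_sigma]
  simp

namespace JordanDecomposition

variable {n : ℕ} {A : Matrix (Fin n) (Fin n) ℂ}

/-- The multiset of the sizes of the Jordan blocks with eigenvalue `μ`. -/
noncomputable def blockSizes (J : JordanDecomposition A) (μ : ℂ) : Multiset ℕ :=
  (Finset.univ.filter fun i => J.ev i = μ).val.map J.sz

lemma blockSizes_sum (J : JordanDecomposition A) (μ : ℂ) :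
    (J.blockSizes μ).sum = eigenMult A μ := by
  have h1 : A.charpoly = ∏ i, (Polynomial.X - Polynomial.C (J.ev i)) ^ J.sz i := by
    rw [← jordanMatrix_charpoly, ← Matrix.charpoly_reindex J.index, ← J.conj_eq]
    exact (Matrix.charpoly_units_conj J.S A).symm
  have h0 : ∏ i, (Polynomial.X - Polynomial.C (J.ev i)) ^ J.sz i ≠ 0 :=
    Finset.prod_ne_zero_iff.2 fun i _ => pow_ne_zero _ (Polynomial.X_sub_C_ne_zero _)
  rw [eigenMult, h1, ← Polynomial.count_roots, Polynomial.roots_prod _ _ h0]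
  simp only [Polynomial.roots_pow, Polynomial.roots_X_sub_C, Multiset.count_bind,
    Multiset.count_nsmul, Multiset.count_singleton]
  rw [blockSizes]
  change ∑ i ∈ Finset.univ.filter (fun i => J.ev i = μ), J.sz i = ∑ i, _
  rw [Finset.sum_filter]
  refine Finset.sum_congr rfl fun i _ => ?_
  by_cases h : J.ev i = μ
  · simp [h]
  · simp [h, Ne.symm h]

/-- The partition `𝐝(p)` of the multiplicity `p` of `μ`, given by the sizes of the Jordan blocks
with eigenvalue `μ`. -/
noncomputable def partition (J : JordanDecomposition A) (μ : ℂ) :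
    Nat.Partition (eigenMult A μ) where
  parts := J.blockSizes μ
  parts_pos := by
    intro i hi
    obtain ⟨j, -, rfl⟩ := Multiset.mem_map.1 hi
    exact J.sz_pos j
  parts_sum := J.blockSizes_sum μ

end JordanDecomposition

/-! ### Parts of a partition -/

/-- The set `𝕆_d` of the odd parts of the partition `d`. -/
def oddParts {m : ℕ} (d : Nat.Partition m) : Finset ℕ :=
  d.parts.toFinset.filter fun η => Odd η

/-- The set `𝔼_d` of the even parts of the partition `d`. -/
def evenParts {m : ℕ} (d : Nat.Partition m) : Finset ℕ :=
  d.parts.toFinset.filter fun η => Even η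

/-- The set `𝔼²_d` of the even parts `η` of the partition `d` with `η ≡ 2 (mod 4)`. -/
def evenPartsTwoModFour {m : ℕ} (d : Nat.Partition m) : Finset ℕ :=
  (evenParts d).filter fun η => η ≡ 2 [MOD 4]

/-- The number of elements of `𝔼²_d`, every part `η` being counted as often as it occurs in `d`:
for `d = [d₁^t₁, …, d_s^t_s]` this is the sum of the `t_i` over the `i` with `d_i ≡ 2 (mod 4)`. -/
def countTwoModFour {m : ℕ} (d : Nat.Partition m) : ℕ :=
  ∑ η ∈ evenPartsTwoModFour d, d.parts.count η

/-! ### Existence of Jordan decompositions -/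

/-- The basis `(X - a)^(m-1), …, X - a, 1` of `ℂ[X] / ((X - a)^m)`. -/
lemma exists_chain_basis (a : ℂ) (m : ℕ) :
    ∃ b : Module.Basis (Fin m) ℂ
      (Polynomial ℂ ⧸ Submodule.span (Polynomial ℂ) {(Polynomial.X - Polynomial.C a) ^ m}),
      ∀ j, b j = Submodule.Quotient.mk ((Polynomial.X - Polynomial.C a) ^ (m - 1 - (j : ℕ))) := by
  have hfr : Module.finrank ℂ (Polynomial ℂ ⧸
      Submodule.span (Polynomial ℂ) {(Polynomial.X - Polynomial.C a) ^ m}) = m := by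
    have := finrank_quotient_span_eq_natDegree (f := (Polynomial.X - Polynomial.C a) ^ m)
    rw [Polynomial.natDegree_pow, Polynomial.natDegree_X_sub_C, mul_one] at this
    exact this
  refine ⟨basisOfTopLeSpanOfCardEqFinrank
    (fun j : Fin m => Submodule.Quotient.mk
      ((Polynomial.X - Polynomial.C a) ^ (m - 1 - (j : ℕ)))) ?_ (by simp [hfr]), fun j => by
      rw [coe_basisOfTopLeSpanOfCardEqFinrank]⟩
  rintro x -
  obtain ⟨g, rfl⟩ := Submodule.Quotient.mk_surjective _ x
  rw [← Polynomial.sum_taylor_eq g a, Polynomial.sum, ← Submodule.mkQ_apply, map_sum]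
  refine Submodule.sum_mem _ fun i _ => ?_
  rw [← Polynomial.smul_eq_C_mul, Submodule.mkQ_apply, Submodule.Quotient.mk_smul]
  refine Submodule.smul_mem _ _ ?_
  by_cases hi : i < m
  · refine Submodule.subset_span ⟨⟨m - 1 - i, by omega⟩, ?_⟩
    have : m - 1 - (m - 1 - i) = i := by omega
    simp only [this]
  · rw [(Submodule.Quotient.mk_eq_zero _).2]
    · exact Submodule.zero_mem _
    · exact Ideal.mem_span_singleton.2 (pow_dvd_pow _ (by omega))

open Classical in
/-- `J(a, m)` is the matrix of multiplication by `X` in the basis of `exists_chain_basis`. -/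
lemma repr_X_smul (a : ℂ) (m : ℕ)
    (b : Module.Basis (Fin m) ℂ
      (Polynomial ℂ ⧸ Submodule.span (Polynomial ℂ) {(Polynomial.X - Polynomial.C a) ^ m}))
    (hb : ∀ j, b j =
      Submodule.Quotient.mk ((Polynomial.X - Polynomial.C a) ^ (m - 1 - (j : ℕ))))
    (i j : Fin m) :
    b.repr ((Polynomial.X : Polynomial ℂ) • b j) i = jordanBlock a m i j := by
  have hX : ∀ v : (Polynomial ℂ ⧸
      Submodule.span (Polynomial ℂ) {(Polynomial.X - Polynomial.C a) ^ m}),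
      (Polynomial.X : Polynomial ℂ) • v =
        a • v + (Polynomial.X - Polynomial.C a : Polynomial ℂ) • v := by
    intro v
    rw [sub_smul, ← algebraMap_smul (Polynomial ℂ) a v]
    simp
  have hmul : (Polynomial.X - Polynomial.C a : Polynomial ℂ) • b j =
      Submodule.Quotient.mk ((Polynomial.X - Polynomial.C a) ^ (m - 1 - (j : ℕ) + 1)) := by
    rw [hb, ← Submodule.Quotient.mk_smul, smul_eq_mul, pow_succ']
  rw [hX, map_add, map_smul]
  by_cases hj : (j : ℕ) = 0
  · have h0 : (Polynomial.X - Polynomial.C a : Polynomial ℂ) • b j = 0 := by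
      rw [hmul, Submodule.Quotient.mk_eq_zero]
      exact Ideal.mem_span_singleton.2 (pow_dvd_pow _ (by omega))
    rw [h0]
    by_cases hij : i = j
    · simp [jordanBlock, hij]
    · have : ¬ ((i : ℕ) + 1 = j) := by omega
      simp [jordanBlock, hij, this]
  · have h1 : (Polynomial.X - Polynomial.C a : Polynomial ℂ) • b j =
        b ⟨(j : ℕ) - 1, by omega⟩ := by
      rw [hmul, hb]
      have : m - 1 - (j : ℕ) + 1 = m - 1 - ((j : ℕ) - 1) := by omega
      simp only [this]
    rw [h1]
    by_cases hij : i = j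
    · subst hij
      have : (⟨(i : ℕ) - 1, by omega⟩ : Fin m) ≠ i := by
        intro h
        have := congrArg Fin.val h
        simp only at this
        omega
      simp [jordanBlock, this]
    · by_cases hij' : (i : ℕ) + 1 = j
      · have : (⟨(j : ℕ) - 1, by omega⟩ : Fin m) = i := by
          apply Fin.ext
          simp only
          omega
        simp [jordanBlock, hij, hij', this]
      · have : (⟨(j : ℕ) - 1, by omega⟩ : Fin m) ≠ i := by
          intro h
          have := congrArg Fin.val h
          simp only at this
          omega
        simp [jordanBlock, hij, hij', this]

open Classical in
/-- Every complex square matrix has a Jordan decomposition, so that the partitions `𝐝(p)` and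
`𝐝(q)` exist for every matrix. -/
theorem nonempty_jordanDecomposition {n : ℕ} (A : Matrix (Fin n) (Fin n) ℂ) :
    Nonempty (JordanDecomposition A) := by
  obtain ⟨ι, _, p, hp, m, ⟨E⟩⟩ := Module.equiv_directSum_of_isTorsion
    (Module.AEval.isTorsion_of_finiteDimensional (K := ℂ) (M := Fin n → ℂ) (Matrix.toLin' A))
  have hroot : ∀ i, ∃ a : ℂ, Associated (p i) (Polynomial.X - Polynomial.C a) := by
    intro i
    have hdeg : (p i).degree ≠ 0 := by
      rw [IsAlgClosed.degree_eq_one_of_irreducible ℂ (hp i)]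
      exact one_ne_zero
    obtain ⟨a, ha⟩ := IsAlgClosed.exists_root (p i) hdeg
    exact ⟨a, ((Polynomial.irreducible_X_sub_C a).associated_of_dvd (hp i)
      (Polynomial.dvd_iff_isRoot.2 ha)).symm⟩
  choose a ha using hroot
  have hspan : ∀ i, Submodule.span (Polynomial ℂ) {p i ^ m i} =
      Submodule.span (Polynomial ℂ) {(Polynomial.X - Polynomial.C (a i)) ^ m i} := fun i =>
    Ideal.span_singleton_eq_span_singleton.2 ((ha i).pow_pow)
  have hblock : ∀ i, ∃ b : Module.Basis (Fin (m i)) ℂ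
      (Polynomial ℂ ⧸ Submodule.span (Polynomial ℂ) {p i ^ m i}),
      ∀ r s, b.repr ((Polynomial.X : Polynomial ℂ) • b s) r = jordanBlock (a i) (m i) r s := by
    intro i
    rw [hspan i]
    obtain ⟨b, hb⟩ := exists_chain_basis (a i) (m i)
    exact ⟨b, repr_X_smul _ _ b hb⟩
  choose b hb using hblock
  let B0 := DFinsupp.basis b
  let F := (Module.AEval.of ℂ (Fin n → ℂ) (Matrix.toLin' A)).trans (E.restrictScalars ℂ)
  let B := B0.map F.symm
  have hF : ∀ v, F (A.mulVec v) = (Polynomial.X : Polynomial ℂ) • F v := by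
    intro v
    have h := Module.AEval.X_smul_of (R := ℂ) (Matrix.toLin' A) v
    have h2 := congrArg E h
    rw [map_smul] at h2
    exact h2.symm
  have hB : ∀ x y, B.repr (A.mulVec (B y)) x =
      Matrix.blockDiagonal' (fun i => jordanBlock (a i) (m i)) x y := by
    rintro ⟨i, r⟩ ⟨j, s⟩
    change B0.repr (F (A.mulVec (F.symm (B0 ⟨j, s⟩)))) ⟨i, r⟩ = _
    rw [hF, LinearEquiv.apply_symm_apply]
    have hrepr : ∀ f i r, B0.repr f ⟨i, r⟩ = (b i).repr (f i) r := fun _ _ _ => rfl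
    have hB0 : B0 ⟨j, s⟩ = DFinsupp.single j (b j s) := by
      apply B0.repr.injective
      ext ⟨i', r'⟩
      rw [Module.Basis.repr_self, hrepr]
      by_cases h : i' = j
      · subst h
        simp [Finsupp.single_apply, eq_comm]
      · rw [DFinsupp.single_eq_of_ne h, Finsupp.single_apply, if_neg]
        · simp
        · intro h'
          exact h (congrArg Sigma.fst h').symm
    have hsmul : ((Polynomial.X : Polynomial ℂ) • (B0 ⟨j, s⟩)) i =
        (Polynomial.X : Polynomial ℂ) • (B0 ⟨j, s⟩ i) := DFinsupp.smul_apply _ _ _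
    refine (hrepr _ _ _).trans ?_
    refine (congrArg (fun z => (b i).repr z r) hsmul).trans ?_
    rw [hB0, Matrix.blockDiagonal'_apply]
    by_cases h : i = j
    · subst h
      simp [hb]
    · rw [DFinsupp.single_eq_of_ne h, dif_neg h]
      simp
  let P := {i // 0 < m i}
  let σ : Fin (Fintype.card P) ≃ P := (Fintype.equivFin P).symm
  let t : (Σ i : Fin (Fintype.card P), Fin (m (σ i))) → Σ i, Fin (m i) :=
    fun x => ⟨σ x.1, x.2⟩
  have ht : Function.Bijective t := by
    constructor
    · rintro ⟨i, r⟩ ⟨j, s⟩ h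
      have h1 : i = j := σ.injective (Subtype.ext (congrArg Sigma.fst h))
      subst h1
      simpa [t] using h
    · rintro ⟨i, r⟩
      obtain ⟨j, hj⟩ := σ.surjective ⟨i, r.pos⟩
      have hj' : (σ j : ι) = i := by rw [hj]
      subst hj'
      exact ⟨⟨j, r⟩, rfl⟩
  let τ := Equiv.ofBijective t ht
  let ε : (Σ i, Fin (m i)) ≃ Fin n := B.indexEquiv (Pi.basisFun ℂ (Fin n))
  let B' := B.reindex ε
  refine ⟨⟨Fintype.card P, fun i => a (σ i), fun i => m (σ i), fun i => (σ i).2, τ.trans ε,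
    ⟨B'.toMatrix (Pi.basisFun ℂ (Fin n)), (Pi.basisFun ℂ (Fin n)).toMatrix B',
      Module.Basis.toMatrix_mul_toMatrix_flip _ _,
      Module.Basis.toMatrix_mul_toMatrix_flip _ _⟩, ?_⟩⟩
  dsimp only
  rw [Matrix.inv_eq_right_inv (Module.Basis.toMatrix_mul_toMatrix_flip B'
    (Pi.basisFun ℂ (Fin n)))]
  conv_lhs => rw [← LinearMap.toMatrix'_toLin' A, ← LinearMap.toMatrix_eq_toMatrix',
    basis_toMatrix_mul_linearMap_toMatrix_mul_basis_toMatrix]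
  ext x y
  obtain ⟨x, rfl⟩ := (τ.trans ε).surjective x
  obtain ⟨y, rfl⟩ := (τ.trans ε).surjective y
  rw [Matrix.reindex_apply, Matrix.submatrix_apply, Equiv.symm_apply_apply,
    Equiv.symm_apply_apply, LinearMap.toMatrix_apply]
  simp only [B', Module.Basis.reindex_apply, Module.Basis.repr_reindex_apply, Equiv.trans_apply,
    Equiv.symm_apply_apply, Matrix.toLin'_apply]
  rw [hB, jordanMatrix]
  obtain ⟨i, r⟩ := x
  obtain ⟨j, s⟩ := y
  change Matrix.blockDiagonal' (fun i => jordanBlock (a i) (m i)) ⟨(σ i : ι), r⟩ ⟨(σ j : ι), s⟩ = _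
  by_cases h : i = j
  · subst h
    simp [Matrix.blockDiagonal'_apply_eq]
  · have h' : (σ i : ι) ≠ σ j := fun h0 => h (σ.injective (Subtype.ext h0))
    rw [Matrix.blockDiagonal'_apply_ne _ _ _ h, Matrix.blockDiagonal'_apply_ne _ _ _ h']

end StrongReversibility

namespace StrongReversibility

open Matrix

/-! ### Products with Jordan blocks -/

/-! Write `A = ab` with `a`, `b` involutions; then `A a A = a`. Conversely, an involution `a` with
`A a A = a` gives `A = a (a A)`, where `a A` is again an involution. So the question is whether some
involution of determinant `1` reverses `A` (`isStronglyReversible_iff`), and it can be asked of the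
Jordan form `M` of `A`.

A reversing involution of some determinant always exists (`exists_involution_jordanMatrix`). On a
block with eigenvalue `l = ±1` it is the substitution `t ↦ -t / (1 + l t)`, which sends `l + t` to
its inverse. For `l ≠ l⁻¹`, a given reversing `h` carries the blocks of `l` to those of `l⁻¹`, and
`h⁻¹` is used for the way back. If some block with eigenvalue `±1` has odd size, changing the sign
of the involution on that block corrects the determinant if necessary.

If all these blocks have even size, there is no freedom. The diagonal blocks of any `X` with `M X M
= X` are zero for `l² ≠ 1`, and triangular with alternating diagonal for `l² = 1`, so `X` has trace
zero. A reversing involution therefore has determinant `(-1) ^ (n / 2)`, which is `1` exactly when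
`4 ∣ n`. As all parts are even, `p` and `q` are congruent modulo `4` to twice their numbers of parts
`≡ 2 (mod 4)`, which turns `4 ∣ n` into the second condition. -/

lemma jordanBlock_mul_apply {m : ℕ} {κ : Type*} (μ : ℂ) (X : Matrix (Fin m) κ ℂ)
    (i : Fin m) (j : κ) :
    (jordanBlock μ m * X) i j =
      μ * X i j + if h : (i : ℕ) + 1 < m then X ⟨i + 1, h⟩ j else 0 := by
  rw [Matrix.mul_apply, ← Finset.add_sum_erase _ _ (Finset.mem_univ i)]
  congr 1
  · simp [jordanBlock]
  · split_ifs with h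
    · rw [Finset.sum_eq_single ⟨i + 1, h⟩]
      · simp [jordanBlock, Fin.ext_iff]
      · intro x hx hx'
        have h1 : i ≠ x := (Finset.ne_of_mem_erase hx).symm
        have h2 : ¬ ((i : ℕ) + 1 = x) := fun h' => hx' (Fin.ext h'.symm)
        simp [jordanBlock, h1, h2]
      · simp [Fin.ext_iff]
    · refine Finset.sum_eq_zero fun x hx => ?_
      have h1 : i ≠ x := (Finset.ne_of_mem_erase hx).symm
      have h2 : ¬ ((i : ℕ) + 1 = x) := by omega
      simp [jordanBlock, h1, h2]

lemma mul_jordanBlock_apply {m : ℕ} {κ : Type*} (μ : ℂ) (X : Matrix κ (Fin m) ℂ)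
    (i : κ) (j : Fin m) :
    (X * jordanBlock μ m) i j =
      μ * X i j + if (j : ℕ) = 0 then 0 else X i ⟨j - 1, by omega⟩ := by
  rw [Matrix.mul_apply, ← Finset.add_sum_erase _ _ (Finset.mem_univ j)]
  congr 1
  · simp [jordanBlock, mul_comm]
  · split_ifs with h
    · refine Finset.sum_eq_zero fun x hx => ?_
      have h1 : x ≠ j := Finset.ne_of_mem_erase hx
      have h2 : ¬ ((x : ℕ) + 1 = j) := by omega
      simp [jordanBlock, h1, h2]
    · rw [Finset.sum_eq_single ⟨j - 1, by omega⟩]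
      · have h1 : ¬ ((j : ℕ) - 1 = j) := by omega
        have h2 : (j : ℕ) - 1 + 1 = j := by omega
        simp [jordanBlock, Fin.ext_iff, h1, h2]
      · intro x hx hx'
        have h1 : x ≠ j := Finset.ne_of_mem_erase hx
        have h2 : ¬ ((x : ℕ) + 1 = j) := fun h' => hx' (Fin.ext (by simp only; omega))
        simp [jordanBlock, h1, h2]
      · have h1 : ¬ ((j : ℕ) - 1 = j) := by omega
        simp [Fin.ext_iff, h1]

/-- The entries of a matrix, extended by `0` to all pairs of natural numbers. -/
def extEntry {m k : ℕ} (X : Matrix (Fin m) (Fin k) ℂ) (i j : ℕ) : ℂ :=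
  if h : i < m ∧ j < k then X ⟨i, h.1⟩ ⟨j, h.2⟩ else 0

lemma extEntry_coe {m k : ℕ} (X : Matrix (Fin m) (Fin k) ℂ) (i : Fin m) (j : Fin k) :
    extEntry X i j = X i j := by
  simp [extEntry]

/-- Expansion of `(l + N) X (μ + N)`. Extension by zero absorbs the missing row below the last one;
column `0` needs its own case because `j - 1` is truncated. -/
lemma jordanBlock_mul_mul_jordanBlock_apply {m k : ℕ} (l μ : ℂ)
    (X : Matrix (Fin m) (Fin k) ℂ) (i : Fin m) (j : Fin k) :
    (jordanBlock l m * X * jordanBlock μ k) i j =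
      l * μ * extEntry X i j + μ * extEntry X (i + 1) j +
        if (j : ℕ) = 0 then 0 else l * extEntry X i (j - 1) + extEntry X (i + 1) (j - 1) := by
  have hj : (j : ℕ) - 1 < k := by omega
  rw [mul_jordanBlock_apply, jordanBlock_mul_apply, jordanBlock_mul_apply]
  simp only [extEntry, i.2, j.2, hj, and_true, dif_pos, Fin.eta]
  split_ifs <;> ring

/-- A solution of `J(l, m) X J(μ, k) = X` vanishes unless `l μ = 1`. -/
lemma eq_zero_of_jordanBlock_mul_mul {m k : ℕ} {l μ : ℂ} (hlμ : l * μ ≠ 1)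
    {X : Matrix (Fin m) (Fin k) ℂ} (hX : jordanBlock l m * X * jordanBlock μ k = X) :
    X = 0 := by
  -- Induction on the distance from the bottom-left corner: the equation expresses `(l μ - 1) X i j`
  -- through entries below and to the left.
  have key : ∀ s i j : ℕ, j + (m - i) ≤ s → extEntry X i j = 0 := by
    intro s
    induction s with
    | zero =>
      intro i j h
      rw [extEntry, dif_neg]
      omega
    | succ s ih =>
      intro i j h
      by_cases hij : i < m ∧ j < k
      · have h1 := jordanBlock_mul_mul_jordanBlock_apply l μ X ⟨i, hij.1⟩ ⟨j, hij.2⟩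
        rw [hX, ← extEntry_coe X] at h1
        simp only at h1
        rw [ih (i + 1) j (by omega)] at h1
        have h2 : (if j = 0 then 0 else
            l * extEntry X i (j - 1) + extEntry X (i + 1) (j - 1)) = 0 := by
          split_ifs with hj
          · rfl
          · rw [ih i (j - 1) (by omega), ih (i + 1) (j - 1) (by omega)]
            ring
        rw [h2] at h1
        have h3 : (l * μ - 1) * extEntry X i j = 0 := by linear_combination -h1
        exact (mul_eq_zero.1 h3).resolve_left (sub_ne_zero.2 hlμ)
      · rw [extEntry, dif_neg hij]
  ext i j
  rw [← extEntry_coe X, key _ _ _ le_rfl, Matrix.zero_apply]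

/-- For `l² = 1` the term `X i j` cancels from the entrywise equation. What remains forces `X` to be
upper triangular with alternating diagonal, and an alternating sum of even length vanishes. -/
lemma trace_eq_zero_of_jordanBlock_mul_mul {m : ℕ} {l : ℂ} (hl : l * l = 1 → Even m)
    {X : Matrix (Fin m) (Fin m) ℂ} (hX : jordanBlock l m * X * jordanBlock l m = X) :
    X.trace = 0 := by
  by_cases hll : l * l = 1
  swap
  · rw [eq_zero_of_jordanBlock_mul_mul hll hX, Matrix.trace_zero]
  have hl0 : l ≠ 0 := by
    rintro rfl
    simp at hll
  have hrec : ∀ i j : ℕ, i < m → j < m → l * extEntry X (i + 1) j +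
      (if j = 0 then 0 else l * extEntry X i (j - 1) + extEntry X (i + 1) (j - 1)) = 0 := by
    intro i j hi hj
    have h1 := jordanBlock_mul_mul_jordanBlock_apply l l X ⟨i, hi⟩ ⟨j, hj⟩
    rw [hX, ← extEntry_coe X, hll] at h1
    simp only at h1
    linear_combination -h1
  -- Induction on the column, for all rows at once: the equation at `(i - 1, j)` gives `l X i j` in
  -- terms of column `j - 1`.
  have hlow : ∀ j i : ℕ, j < i → extEntry X i j = 0 := by
    intro j
    induction j with
    | zero =>
      intro i hi
      by_cases him : i < m
      · have h1 := hrec (i - 1) 0 (by omega) (by omega)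
        rw [if_pos rfl, add_zero, Nat.sub_add_cancel hi] at h1
        exact (mul_eq_zero.1 h1).resolve_left hl0
      · rw [extEntry, dif_neg]
        omega
    | succ j ih =>
      intro i hi
      by_cases him : i < m
      · have h1 := hrec (i - 1) (j + 1) (by omega) (by omega)
        rw [if_neg (by omega), Nat.sub_add_cancel (by omega : 1 ≤ i), Nat.add_sub_cancel,
          ih (i - 1) (by omega), ih i (by omega), mul_zero, add_zero, add_zero] at h1
        exact (mul_eq_zero.1 h1).resolve_left hl0
      · rw [extEntry, dif_neg]
        omega
  have hdiag : ∀ i : ℕ, i < m → extEntry X i i = (-1) ^ i * extEntry X 0 0 := by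
    intro i
    induction i with
    | zero => simp
    | succ i ih =>
      intro hi
      have h1 := hrec i (i + 1) (by omega) hi
      rw [if_neg (by omega), Nat.add_sub_cancel, hlow i (i + 1) (by omega),
        ih (by omega)] at h1
      refine mul_left_cancel₀ hl0 ?_
      rw [pow_succ]
      linear_combination h1
  have htr : X.trace = ∑ i ∈ Finset.range m, (-1) ^ i * extEntry X 0 0 := by
    rw [← Fin.sum_univ_eq_sum_range (fun i => (-1) ^ i * extEntry X 0 0), Matrix.trace]
    refine Finset.sum_congr rfl fun i _ => ?_
    rw [← hdiag i i.2, extEntry_coe, Matrix.diag_apply]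
  rw [htr, ← Finset.sum_mul, neg_one_geom_sum, if_pos (hl hll), zero_mul]

/-! ### Involutions reversing a Jordan block with eigenvalue `±1` -/

/-- The coefficient of `t ^ j` in `(-t / (1 + l t)) ^ i`. -/
def flipCoeff (l : ℂ) : ℕ → ℕ → ℂ
  | 0, 0 => 1
  | 0, _ + 1 => 0
  | _ + 1, 0 => 0
  | i + 1, j + 1 => -flipCoeff l i j - l * flipCoeff l (i + 1) j

lemma flipCoeff_of_lt (l : ℂ) : ∀ j i : ℕ, j < i → flipCoeff l i j = 0
  | 0, i + 1, _ => by rw [flipCoeff]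
  | j + 1, i + 1, h => by
    rw [flipCoeff, flipCoeff_of_lt l j i (by omega), flipCoeff_of_lt l j (i + 1) (by omega)]
    ring

/-- The matrix of the involution `t ↦ -t / (1 + l t)` of `ℂ[t] / (t ^ m)`. -/
def flipMatrix (l : ℂ) (m : ℕ) : Matrix (Fin m) (Fin m) ℂ :=
  Matrix.of fun i j => flipCoeff l i j

/-- Only the column needs a bound: below the last row the coefficient is already zero by
triangularity. -/
lemma extEntry_flipMatrix (l : ℂ) (m i j : ℕ) (hj : j < m) :
    extEntry (flipMatrix l m) i j = flipCoeff l i j := by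
  by_cases hi : i < m
  · simp [extEntry, hi, hj, flipMatrix]
  · rw [flipCoeff_of_lt l j i (by omega), extEntry, dif_neg (by omega)]

/-- Up to the factor `l`, the recursion of `flipCoeff` is the entrywise equation `l X (i+1) (j+1) +
l X i j + X (i+1) j = 0`. -/
lemma jordanBlock_mul_flipMatrix_mul {l : ℂ} (hl : l * l = 1) (m : ℕ) :
    jordanBlock l m * flipMatrix l m * jordanBlock l m = flipMatrix l m := by
  ext i j
  rw [jordanBlock_mul_mul_jordanBlock_apply, ← extEntry_coe (flipMatrix l m), hl,
    extEntry_flipMatrix _ _ _ _ j.2, extEntry_flipMatrix _ _ _ _ j.2,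
    extEntry_flipMatrix _ _ _ _ (by omega), extEntry_flipMatrix _ _ _ _ (by omega)]
  split_ifs with hj
  · rw [hj, flipCoeff]
    ring
  · obtain ⟨b, hb⟩ := Nat.exists_eq_succ_of_ne_zero hj
    rw [hb, Nat.succ_eq_add_one, Nat.add_sub_cancel, flipCoeff]
    linear_combination (-flipCoeff l (i + 1) b) * hl

/-- A matrix that commutes with a Jordan block is determined by its first row. -/
lemma eq_one_of_commute_jordanBlock {m : ℕ} {l : ℂ} {Q : Matrix (Fin m) (Fin m) ℂ}
    (hQ : jordanBlock l m * Q = Q * jordanBlock l m)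
    (h0 : ∀ i j : Fin m, (i : ℕ) = 0 → Q i j = if i = j then 1 else 0) : Q = 1 := by
  have key : ∀ (i : ℕ) (hi : i < m) (j : Fin m),
      Q ⟨i, hi⟩ j = if (⟨i, hi⟩ : Fin m) = j then 1 else 0 := by
    intro i
    induction i with
    | zero => exact fun hi j => h0 _ _ rfl
    | succ i ih =>
      intro hi j
      -- Comparing entries gives `Q (i+1) j = Q i (j-1)`, or `0` when `j = 0`: each row is the
      -- previous one shifted.
      have h1 := congrFun (congrFun hQ ⟨i, by omega⟩) j
      rw [jordanBlock_mul_apply, mul_jordanBlock_apply, add_right_inj, dif_pos hi] at h1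
      rw [h1]
      split_ifs with hj h2 h2
      · simp [Fin.ext_iff] at h2
        omega
      · rfl
      · rw [ih, if_pos]
        simp [Fin.ext_iff] at h2 ⊢
        omega
      · rw [ih, if_neg]
        simp [Fin.ext_iff] at h2 ⊢
        omega
  ext i j
  rw [key i i.2 j, Matrix.one_apply]

/-- Inverting the Jordan block twice gives it back, so the square commutes with it, and its first
row is that of the identity. -/
lemma flipMatrix_mul_self {l : ℂ} (hl : l * l = 1) (m : ℕ) :
    flipMatrix l m * flipMatrix l m = 1 := by
  have h := jordanBlock_mul_flipMatrix_mul hl m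
  refine eq_one_of_commute_jordanBlock (l := l) ?_ ?_
  · calc jordanBlock l m * (flipMatrix l m * flipMatrix l m)
        = jordanBlock l m * (flipMatrix l m *
          (jordanBlock l m * flipMatrix l m * jordanBlock l m)) := by rw [h]
      _ = (jordanBlock l m * flipMatrix l m * jordanBlock l m) *
          flipMatrix l m * jordanBlock l m := by simp only [Matrix.mul_assoc]
      _ = flipMatrix l m * flipMatrix l m * jordanBlock l m := by rw [h]
  · have hrow : ∀ i j : Fin m, (i : ℕ) = 0 →
        flipMatrix l m i j = if i = j then 1 else 0 := by
      intro i j hi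
      rw [flipMatrix, Matrix.of_apply, hi]
      split_ifs with hij
      · rw [← hij, hi, flipCoeff]
      · obtain ⟨b, hb⟩ := Nat.exists_eq_succ_of_ne_zero
          (fun hj : (j : ℕ) = 0 => hij (Fin.ext (hi.trans hj.symm)))
        rw [hb, flipCoeff]
    intro i j hi
    rw [Matrix.mul_apply, Finset.sum_eq_single i]
    · rw [hrow i i hi, if_pos rfl, one_mul, hrow i j hi]
    · intro x _ hx
      rw [hrow i x hi, if_neg hx.symm, zero_mul]
    · simp

/-! ### Involutions of trace zero -/

/-- Take determinants in `(r - a) (r + a) = r² - 1`; the first factor is singular. -/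
lemma sq_eq_one_of_mem_roots_charpoly {ι : Type*} [Fintype ι] [DecidableEq ι]
    {a : Matrix ι ι ℂ} (ha : a * a = 1) {r : ℂ} (hr : r ∈ a.charpoly.roots) : r * r = 1 := by
  by_contra h
  have h0 : (Matrix.scalar ι r - a).det = 0 := by
    rw [← Matrix.eval_charpoly]
    exact Polynomial.isRoot_of_mem_roots hr
  have h1 : (Matrix.scalar ι r - a) * (Matrix.scalar ι r + a) = Matrix.scalar ι (r * r - 1) := by
    have hc : Matrix.scalar ι r * a = a * Matrix.scalar ι r :=
      Matrix.scalar_commute r (fun _ => Commute.all _ _) a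
    rw [sub_mul, mul_add, mul_add, ha, hc, map_sub, map_mul, map_one]
    abel
  have h2 := congrArg Matrix.det h1
  rw [Matrix.det_mul, h0, zero_mul, Matrix.scalar_apply, Matrix.det_diagonal] at h2
  exact (Finset.prod_ne_zero_iff.2 fun _ _ => sub_ne_zero.2 h) h2.symm

/-- The witness `k` counts the entries equal to `-1`. -/
lemma exists_sum_prod_of_mul_self_eq_one (s : Multiset ℂ) (hs : ∀ r ∈ s, r * r = 1) :
    ∃ k : ℕ, s.sum + 2 * (k : ℂ) = (s.card : ℂ) ∧ s.prod = (-1) ^ k := by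
  induction s using Multiset.induction_on with
  | empty => exact ⟨0, by simp⟩
  | cons r s ih =>
    obtain ⟨k, h1, h2⟩ := ih fun x hx => hs x (Multiset.mem_cons_of_mem hx)
    rcases mul_self_eq_one_iff.1 (hs r (Multiset.mem_cons_self r s)) with rfl | rfl
    · refine ⟨k, ?_, by simp [h2]⟩
      rw [Multiset.sum_cons, Multiset.card_cons]
      push_cast
      linear_combination h1
    · refine ⟨k + 1, ?_, by simp [h2, pow_succ]⟩
      rw [Multiset.sum_cons, Multiset.card_cons]
      push_cast
      linear_combination h1

/-- An involution of trace zero has the eigenvalues `1` and `-1` equally often. -/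
lemma det_of_mul_self_eq_one_of_trace_eq_zero {ι : Type*} [Fintype ι] [DecidableEq ι]
    {a : Matrix ι ι ℂ} (ha : a * a = 1) (htr : a.trace = 0) :
    ∃ k : ℕ, Fintype.card ι = 2 * k ∧ a.det = (-1) ^ k := by
  obtain ⟨k, h1, h2⟩ := exists_sum_prod_of_mul_self_eq_one a.charpoly.roots
    fun r hr => sq_eq_one_of_mem_roots_charpoly ha hr
  rw [← Matrix.trace_eq_sum_roots_charpoly, htr, zero_add,
    IsAlgClosed.card_roots_eq_natDegree, Matrix.charpoly_natDegree_eq_dim] at h1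
  exact ⟨k, by exact_mod_cast h1.symm, by rw [Matrix.det_eq_prod_roots_charpoly, h2]⟩

/-! ### Block matrices -/

section Blocks

variable {k : ℕ} {ev : Fin k → ℂ} {sz : Fin k → ℕ}

/-- The block `(i, j)` of a matrix with rows and columns indexed by the blocks of sizes `sz`. -/
def blockAt (X : Matrix (Σ i, Fin (sz i)) (Σ i, Fin (sz i)) ℂ) (i j : Fin k) :
    Matrix (Fin (sz i)) (Fin (sz j)) ℂ :=
  Matrix.of fun r s => X ⟨i, r⟩ ⟨j, s⟩

lemma blockAt_blockDiagonal'_mul (J : ∀ i, Matrix (Fin (sz i)) (Fin (sz i)) ℂ)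
    (X : Matrix (Σ i, Fin (sz i)) (Σ i, Fin (sz i)) ℂ) (i j : Fin k) :
    blockAt (Matrix.blockDiagonal' J * X) i j = J i * blockAt X i j := by
  ext r s
  rw [blockAt, Matrix.of_apply, Matrix.mul_apply, Fintype.sum_sigma, Finset.sum_eq_single i]
  · simp [Matrix.mul_apply, blockAt]
  · intro x _ hx
    exact Finset.sum_eq_zero fun t _ => by
      rw [Matrix.blockDiagonal'_apply_ne _ _ _ hx.symm, zero_mul]
  · simp

lemma blockAt_mul_blockDiagonal' (J : ∀ i, Matrix (Fin (sz i)) (Fin (sz i)) ℂ)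
    (X : Matrix (Σ i, Fin (sz i)) (Σ i, Fin (sz i)) ℂ) (i j : Fin k) :
    blockAt (X * Matrix.blockDiagonal' J) i j = blockAt X i j * J j := by
  ext r s
  rw [blockAt, Matrix.of_apply, Matrix.mul_apply, Fintype.sum_sigma, Finset.sum_eq_single j]
  · simp [Matrix.mul_apply, blockAt]
  · intro x _ hx
    exact Finset.sum_eq_zero fun t _ => by
      rw [Matrix.blockDiagonal'_apply_ne _ _ _ hx, mul_zero]
  · simp

lemma jordanBlock_mul_blockAt_mul {X : Matrix (Σ i, Fin (sz i)) (Σ i, Fin (sz i)) ℂ}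
    (hX : jordanMatrix ev sz * X * jordanMatrix ev sz = X) (i j : Fin k) :
    jordanBlock (ev i) (sz i) * blockAt X i j * jordanBlock (ev j) (sz j) = blockAt X i j := by
  conv_rhs => rw [← hX, jordanMatrix, blockAt_mul_blockDiagonal', blockAt_blockDiagonal'_mul]

/-- A matrix `X` that reverses a Jordan matrix has trace zero if all Jordan blocks with eigenvalue
`±1` have even size. -/
lemma trace_eq_zero_of_jordanMatrix_mul_mul (hev : ∀ i, ev i * ev i = 1 → Even (sz i))
    {X : Matrix (Σ i, Fin (sz i)) (Σ i, Fin (sz i)) ℂ}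
    (hX : jordanMatrix ev sz * X * jordanMatrix ev sz = X) : X.trace = 0 := by
  rw [Matrix.trace, Fintype.sum_sigma]
  exact Finset.sum_eq_zero fun i _ =>
    trace_eq_zero_of_jordanBlock_mul_mul (hev i) (jordanBlock_mul_blockAt_mul hX i i)

lemma apply_eq_zero_of_jordanMatrix_mul_mul
    {X : Matrix (Σ i, Fin (sz i)) (Σ i, Fin (sz i)) ℂ}
    (hX : jordanMatrix ev sz * X * jordanMatrix ev sz = X) {x y : Σ i, Fin (sz i)}
    (hxy : ev x.1 * ev y.1 ≠ 1) : X x y = 0 :=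
  congrFun (congrFun
    (eq_zero_of_jordanBlock_mul_mul hxy (jordanBlock_mul_blockAt_mul hX x.1 y.1)) x.2) y.2

lemma blockDiagonal'_commute_diagonal (J : ∀ i, Matrix (Fin (sz i)) (Fin (sz i)) ℂ)
    (c : Fin k → ℂ) :
    Commute (Matrix.blockDiagonal' J) (diagonal fun x : Σ i, Fin (sz i) => c x.1) := by
  ext x y
  rw [Matrix.mul_diagonal, Matrix.diagonal_mul, Matrix.blockDiagonal'_apply]
  split_ifs with h
  · rw [show c y.1 = c x.1 from congrArg c h.symm, mul_comm]
  · rw [zero_mul, mul_zero]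

/-! ### Involutions reversing a Jordan matrix -/

/-- A choice of one element of each pair `{l, l⁻¹}` with `l ≠ l⁻¹`. -/
def IsChosen (l : ℂ) : Prop := WellOrderingRel l l⁻¹

lemma not_isChosen_inv {l : ℂ} (h : IsChosen l) : ¬ IsChosen l⁻¹ := by
  rw [IsChosen, inv_inv]
  exact asymm_of WellOrderingRel h

lemma isChosen_or_isChosen_inv {l : ℂ} (h : l ≠ l⁻¹) : IsChosen l ∨ IsChosen l⁻¹ := by
  rw [IsChosen, IsChosen, inv_inv]
  rcases trichotomous_of WellOrderingRel l l⁻¹ with h' | h' | h'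
  · exact Or.inl h'
  · exact absurd h' h
  · exact Or.inr h'

lemma not_isChosen_of_mul_self_eq_one {l : ℂ} (h : l * l = 1) : ¬ IsChosen l := by
  intro h'
  have h1 : l⁻¹ = l := inv_eq_of_mul_eq_one_right h
  have h2 := not_isChosen_inv h'
  rw [h1] at h2
  exact h2 h'

open Classical in
/-- The projector onto the blocks whose eigenvalue satisfies `P`. -/
noncomputable def blockProj (ev : Fin k → ℂ) (sz : Fin k → ℕ) (P : ℂ → Prop) :
    Matrix (Σ i, Fin (sz i)) (Σ i, Fin (sz i)) ℂ :=
  diagonal fun x => if P (ev x.1) then 1 else 0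

lemma blockProj_mul_self (P : ℂ → Prop) :
    blockProj ev sz P * blockProj ev sz P = blockProj ev sz P := by
  simp [blockProj]

lemma blockProj_mul_eq_zero {P Q : ℂ → Prop} (h : ∀ l, P l → ¬ Q l) :
    blockProj ev sz P * blockProj ev sz Q = 0 := by
  rw [blockProj, blockProj, Matrix.diagonal_mul_diagonal, ← Matrix.diagonal_zero]
  congr 1
  funext x
  by_cases hx : P (ev x.1)
  · simp [h _ hx]
  · simp [hx]

lemma blockDiagonal'_commute_blockProj (J : ∀ i, Matrix (Fin (sz i)) (Fin (sz i)) ℂ)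
    (P : ℂ → Prop) : Commute (Matrix.blockDiagonal' J) (blockProj ev sz P) := by
  classical
  exact blockDiagonal'_commute_diagonal J fun i => if P (ev i) then 1 else 0

open Classical in
/-- The block diagonal matrix of the involutions reversing the Jordan blocks with eigenvalue
`±1`. -/
noncomputable def flipBlocks (ev : Fin k → ℂ) (sz : Fin k → ℕ) :
    Matrix (Σ i, Fin (sz i)) (Σ i, Fin (sz i)) ℂ :=
  Matrix.blockDiagonal' fun i => if ev i * ev i = 1 then flipMatrix (ev i) (sz i) else 0

lemma jordanMatrix_mul_flipBlocks_mul :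
    jordanMatrix ev sz * flipBlocks ev sz * jordanMatrix ev sz = flipBlocks ev sz := by
  rw [jordanMatrix, flipBlocks, ← Matrix.blockDiagonal'_mul, ← Matrix.blockDiagonal'_mul]
  congr 1
  funext i
  split_ifs with h
  · exact jordanBlock_mul_flipMatrix_mul h _
  · simp

/-- Only a projector results, since the blocks with other eigenvalues were set to zero; `swapBlocks`
supplies the complement. -/
lemma flipBlocks_mul_self :
    flipBlocks ev sz * flipBlocks ev sz = blockProj ev sz fun l => l * l = 1 := by
  classical
  rw [flipBlocks, ← Matrix.blockDiagonal'_mul, blockProj]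
  ext x y
  rw [Matrix.blockDiagonal'_apply, Matrix.diagonal_apply]
  obtain ⟨i, r⟩ := x
  obtain ⟨j, s⟩ := y
  by_cases hij : i = j
  · subst hij
    by_cases h : ev i * ev i = 1
    · simp [h, flipMatrix_mul_self h, Matrix.one_apply]
    · simp [h]
  · simp [hij]

lemma flipBlocks_mul_blockProj {P : ℂ → Prop} (h : ∀ l, l * l = 1 → ¬ P l) :
    flipBlocks ev sz * blockProj ev sz P = 0 := by
  classical
  ext x y
  rw [flipBlocks, blockProj, Matrix.mul_diagonal, Matrix.blockDiagonal'_apply, Matrix.zero_apply]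
  obtain ⟨i, r⟩ := x
  obtain ⟨j, s⟩ := y
  by_cases hij : i = j
  · subst hij
    by_cases hi : ev i * ev i = 1
    · simp [h _ hi]
    · simp [hi]
  · simp [hij]

/-- The part of a reversing matrix that exchanges the blocks of distinct eigenvalues `l` and
`l⁻¹`, made into an involution. -/
noncomputable def swapBlocks (ev : Fin k → ℂ) (sz : Fin k → ℕ)
    (h g : Matrix (Σ i, Fin (sz i)) (Σ i, Fin (sz i)) ℂ) :
    Matrix (Σ i, Fin (sz i)) (Σ i, Fin (sz i)) ℂ :=
  blockProj ev sz (fun l => IsChosen l⁻¹) * h * blockProj ev sz IsChosen +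
    blockProj ev sz IsChosen * g * blockProj ev sz (fun l => IsChosen l⁻¹)

lemma jordanMatrix_mul_swapBlocks_mul {h g : Matrix (Σ i, Fin (sz i)) (Σ i, Fin (sz i)) ℂ}
    (hh : jordanMatrix ev sz * h * jordanMatrix ev sz = h)
    (hg : jordanMatrix ev sz * g * jordanMatrix ev sz = g) :
    jordanMatrix ev sz * swapBlocks ev sz h g * jordanMatrix ev sz = swapBlocks ev sz h g := by
  have hc : ∀ P, Commute (jordanMatrix ev sz) (blockProj ev sz P) := fun P =>
    blockDiagonal'_commute_blockProj _ P
  have key : ∀ (P Q : ℂ → Prop) (X : Matrix (Σ i, Fin (sz i)) (Σ i, Fin (sz i)) ℂ),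
      jordanMatrix ev sz * X * jordanMatrix ev sz = X →
      jordanMatrix ev sz * (blockProj ev sz P * X * blockProj ev sz Q) * jordanMatrix ev sz =
        blockProj ev sz P * X * blockProj ev sz Q := by
    intro P Q X hX
    calc jordanMatrix ev sz * (blockProj ev sz P * X * blockProj ev sz Q) * jordanMatrix ev sz
        = (jordanMatrix ev sz * blockProj ev sz P) * X *
          (blockProj ev sz Q * jordanMatrix ev sz) := by simp only [Matrix.mul_assoc]
      _ = (blockProj ev sz P * jordanMatrix ev sz) * X *
          (jordanMatrix ev sz * blockProj ev sz Q) := by rw [(hc P).eq, (hc Q).eq]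
      _ = blockProj ev sz P * (jordanMatrix ev sz * X * jordanMatrix ev sz) *
          blockProj ev sz Q := by simp only [Matrix.mul_assoc]
      _ = _ := by rw [hX]
  rw [swapBlocks, mul_add, add_mul, key _ _ _ hh, key _ _ _ hg]

/-- A reversing matrix maps the blocks of `l` into those of `l⁻¹`, so a projector passes through it
with its predicate inverted. -/
lemma mul_blockProj_of_jordanMatrix_mul_mul
    {h : Matrix (Σ i, Fin (sz i)) (Σ i, Fin (sz i)) ℂ}
    (hh : jordanMatrix ev sz * h * jordanMatrix ev sz = h) (P : ℂ → Prop) :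
    h * blockProj ev sz P = blockProj ev sz (fun l => P l⁻¹) * h := by
  ext x y
  rw [blockProj, blockProj, Matrix.mul_diagonal, Matrix.diagonal_mul]
  by_cases hxy : ev x.1 * ev y.1 = 1
  · rw [inv_eq_of_mul_eq_one_right hxy, mul_comm]
  · rw [apply_eq_zero_of_jordanMatrix_mul_mul hh hxy, zero_mul, mul_zero]

/-- The two summands lead from chosen eigenvalues to their inverses and back by inverse maps; each
summand squares to zero because the two sets are disjoint. -/
lemma swapBlocks_mul_self {h g : Matrix (Σ i, Fin (sz i)) (Σ i, Fin (sz i)) ℂ}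
    (hh : jordanMatrix ev sz * h * jordanMatrix ev sz = h) (hhg : h * g = 1) (hgh : g * h = 1) :
    swapBlocks ev sz h g * swapBlocks ev sz h g =
      blockProj ev sz (fun l => IsChosen l⁻¹) + blockProj ev sz IsChosen := by
  have hP := mul_blockProj_of_jordanMatrix_mul_mul hh IsChosen
  have h1 : blockProj ev sz IsChosen * blockProj ev sz (fun l => IsChosen l⁻¹) = 0 :=
    blockProj_mul_eq_zero fun l hl => not_isChosen_inv hl
  have h2 : blockProj ev sz (fun l => IsChosen l⁻¹) * blockProj ev sz IsChosen = 0 :=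
    blockProj_mul_eq_zero fun l hl hl' => not_isChosen_inv hl' hl
  have hm := blockProj_mul_self (ev := ev) (sz := sz) fun l => IsChosen l⁻¹
  have hp := blockProj_mul_self (ev := ev) (sz := sz) IsChosen
  rw [swapBlocks]
  set p := blockProj ev sz IsChosen
  set m := blockProj ev sz (fun l => IsChosen l⁻¹)
  have e1 : (m * h * p) * (p * g * m) = m := by
    calc (m * h * p) * (p * g * m) = m * (h * (p * p)) * g * m := by simp only [Matrix.mul_assoc]
      _ = m * m * (h * g) * m := by rw [hp, hP]; simp only [Matrix.mul_assoc]
      _ = m := by rw [hhg, Matrix.mul_one, hm, hm]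
  have e2 : (p * g * m) * (m * h * p) = p := by
    calc (p * g * m) * (m * h * p) = p * g * ((m * m) * h) * p := by simp only [Matrix.mul_assoc]
      _ = p * (g * h) * (p * p) := by rw [hm, ← hP]; simp only [Matrix.mul_assoc]
      _ = p := by rw [hgh, Matrix.mul_one, hp, hp]
  have e3 : (m * h * p) * (m * h * p) = 0 := by
    calc (m * h * p) * (m * h * p) = m * h * (p * m) * h * p := by simp only [Matrix.mul_assoc]
      _ = 0 := by rw [h1]; simp
  have e4 : (p * g * m) * (p * g * m) = 0 := by
    calc (p * g * m) * (p * g * m) = p * g * (m * p) * g * m := by simp only [Matrix.mul_assoc]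
      _ = 0 := by rw [h2]; simp
  rw [mul_add, add_mul, add_mul, e1, e2, e3, e4, zero_add, add_zero, add_comm]

/-- A Jordan matrix that is conjugate to its inverse is so by an involution, which may be taken
to commute with all matrices that are scalar on the Jordan blocks with eigenvalue `±1` and the
identity on the others. -/
lemma exists_involution_jordanMatrix {h : Matrix (Σ i, Fin (sz i)) (Σ i, Fin (sz i)) ℂ}
    (hu : IsUnit h) (hh : jordanMatrix ev sz * h * jordanMatrix ev sz = h) :
    ∃ a : Matrix (Σ i, Fin (sz i)) (Σ i, Fin (sz i)) ℂ, a * a = 1 ∧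
      jordanMatrix ev sz * a * jordanMatrix ev sz = a ∧
      ∀ c : Fin k → ℂ, (∀ i, ev i * ev i ≠ 1 → c i = 1) →
        Commute a (diagonal fun x => c x.1) := by
  classical
  obtain ⟨⟨h, g, hhg, hgh⟩, rfl⟩ := hu
  simp only at hh
  have hg : jordanMatrix ev sz * g * jordanMatrix ev sz = g := by
    have h1 : (g * jordanMatrix ev sz * h) * jordanMatrix ev sz = 1 := by
      rw [← hgh]
      conv_rhs => rw [← hh]
      simp only [Matrix.mul_assoc]
    calc jordanMatrix ev sz * g * jordanMatrix ev sz
        = jordanMatrix ev sz * (g * jordanMatrix ev sz * h) * g := by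
          simp only [Matrix.mul_assoc]
          rw [hhg, Matrix.mul_one]
      _ = g := by rw [mul_eq_one_comm.1 h1, Matrix.one_mul]
  -- A zero eigenvalue would make a row of `h` vanish. It must be excluded because `0⁻¹ = 0`, so
  -- that `0` would lie in none of the three projectors.
  have hne : ∀ x : Σ i, Fin (sz i), ev x.1 ≠ 0 := by
    intro x hx
    have h1 := congrFun (congrFun hhg x) x
    rw [Matrix.mul_apply, Matrix.one_apply_eq, Finset.sum_eq_zero] at h1
    · exact zero_ne_one h1
    · intro y _
      rw [apply_eq_zero_of_jordanMatrix_mul_mul hh (by simp [hx]), zero_mul]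
  have hB : ∀ {P : ℂ → Prop}, (∀ l, l * l = 1 → ¬ P l) →
      blockProj ev sz P * flipBlocks ev sz = 0 := fun hP =>
    (blockDiagonal'_commute_blockProj _ _).eq.symm.trans (flipBlocks_mul_blockProj hP)
  have hc1 : ∀ l : ℂ, l * l = 1 → ¬ IsChosen l := fun l => not_isChosen_of_mul_self_eq_one
  have hc2 : ∀ l : ℂ, l * l = 1 → ¬ IsChosen l⁻¹ := fun l hl =>
    not_isChosen_of_mul_self_eq_one (by rw [← mul_inv, hl, inv_one])
  have hBC : flipBlocks ev sz * swapBlocks ev sz h g = 0 := by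
    rw [swapBlocks, mul_add]
    simp only [← Matrix.mul_assoc]
    rw [flipBlocks_mul_blockProj hc1, flipBlocks_mul_blockProj hc2]
    simp
  have hCB : swapBlocks ev sz h g * flipBlocks ev sz = 0 := by
    rw [swapBlocks, add_mul, Matrix.mul_assoc, hB hc1, Matrix.mul_assoc (_ * g), hB hc2]
    simp
  refine ⟨flipBlocks ev sz + swapBlocks ev sz h g, ?_, ?_, ?_⟩
  · rw [mul_add, add_mul, add_mul, hBC, hCB, flipBlocks_mul_self,
      swapBlocks_mul_self hh hhg hgh, zero_add, add_zero, blockProj, blockProj, blockProj,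
      Matrix.diagonal_add, Matrix.diagonal_add, ← Matrix.diagonal_one]
    congr 1
    funext x
    -- Each eigenvalue is exactly one of: `±1`, chosen, inverse of a chosen one. Hence the three
    -- projectors add up to the identity.
    by_cases hx : ev x.1 * ev x.1 = 1
    · simp [hx, hc1 _ hx, hc2 _ hx]
    · have h1 : ev x.1 ≠ (ev x.1)⁻¹ := fun h' => hx (by
        nth_rewrite 2 [h']
        exact mul_inv_cancel₀ (hne x))
      rcases isChosen_or_isChosen_inv h1 with h2 | h2
      · simp [hx, h2, not_isChosen_inv h2]
      · have h3 : ¬ IsChosen (ev x.1) := fun h' => not_isChosen_inv h' h2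
        simp [hx, h2, h3]
  · rw [mul_add, add_mul, jordanMatrix_mul_flipBlocks_mul, jordanMatrix_mul_swapBlocks_mul hh hg]
  · intro c hc
    have hp : ∀ {P : ℂ → Prop}, (∀ l, l * l = 1 → ¬ P l) →
        blockProj ev sz P * (diagonal fun x => c x.1) = blockProj ev sz P := by
      intro P hP
      rw [blockProj, Matrix.diagonal_mul_diagonal]
      congr 1
      funext x
      by_cases hx : ev x.1 * ev x.1 = 1
      · simp [hP _ hx]
      · rw [hc _ hx, mul_one]
    have hp' : ∀ {P : ℂ → Prop}, (∀ l, l * l = 1 → ¬ P l) →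
        (diagonal fun x => c x.1) * blockProj ev sz P = blockProj ev sz P := by
      intro P hP
      refine Eq.trans ?_ (hp hP)
      rw [blockProj, Matrix.diagonal_mul_diagonal, Matrix.diagonal_mul_diagonal]
      simp only [mul_comm]
    refine Commute.add_left (blockDiagonal'_commute_diagonal _ c) ?_
    rw [swapBlocks, commute_iff_eq, add_mul, mul_add]
    simp only [← Matrix.mul_assoc]
    rw [hp' hc1, hp' hc2, Matrix.mul_assoc, hp hc1, Matrix.mul_assoc _ _ (diagonal _), hp hc2]

/-- If some Jordan block with eigenvalue `±1` has odd size, the reversing involution may be taken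
of determinant `1`. -/
lemma exists_involution_jordanMatrix_det_eq_one
    {h : Matrix (Σ i, Fin (sz i)) (Σ i, Fin (sz i)) ℂ}
    (hu : IsUnit h) (hh : jordanMatrix ev sz * h * jordanMatrix ev sz = h)
    {i : Fin k} (hi : ev i * ev i = 1) (hodd : Odd (sz i)) :
    ∃ a : Matrix (Σ i, Fin (sz i)) (Σ i, Fin (sz i)) ℂ, a * a = 1 ∧
      jordanMatrix ev sz * a * jordanMatrix ev sz = a ∧ a.det = 1 := by
  obtain ⟨a, ha, hM, hc⟩ := exists_involution_jordanMatrix hu hh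
  have hdet : a.det = 1 ∨ a.det = -1 :=
    mul_self_eq_one_iff.1 (by rw [← Matrix.det_mul, ha, Matrix.det_one])
  rcases hdet with hdet | hdet
  · exact ⟨a, ha, hM, hdet⟩
  -- The sign change on block `i` has determinant `(-1) ^ sz i = -1`, and it commutes with both the
  -- involution and the Jordan matrix.
  let c : Fin k → ℂ := fun j => if j = i then -1 else 1
  have hcc : ∀ j, c j * c j = 1 := by
    intro j
    by_cases hj : j = i <;> simp [c, hj]
  set D : Matrix (Σ i, Fin (sz i)) (Σ i, Fin (sz i)) ℂ := diagonal fun x => c x.1 with hDdef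
  have hDD : D * D = 1 := by
    rw [hDdef, Matrix.diagonal_mul_diagonal, ← Matrix.diagonal_one]
    simp only [hcc]
  have hDa : Commute a D := hc c fun j hj => if_neg (by
    rintro rfl
    exact hj hi)
  have hDM : Commute (jordanMatrix ev sz) D := blockDiagonal'_commute_diagonal _ c
  have hDdet : D.det = -1 := by
    rw [hDdef, Matrix.det_diagonal, Fintype.prod_sigma, Finset.prod_eq_single i]
    · simp [c, hodd.neg_one_pow]
    · intro j _ hj
      simp [c, hj]
    · simp
  refine ⟨D * a, ?_, ?_, ?_⟩
  · calc D * a * (D * a) = D * (a * D) * a := by simp only [Matrix.mul_assoc]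
      _ = (D * D) * (a * a) := by rw [hDa.eq]; simp only [Matrix.mul_assoc]
      _ = 1 := by rw [hDD, ha, Matrix.mul_one]
  · rw [← Matrix.mul_assoc, hDM.eq, Matrix.mul_assoc D, Matrix.mul_assoc D, hM]
  · rw [Matrix.det_mul, hDdet, hdet]
    norm_num

end Blocks

/-! ### Parts of a partition modulo `4` -/

lemma countTwoModFour_eq_card {m : ℕ} (d : Nat.Partition m) :
    countTwoModFour d = (d.parts.filter fun η => η % 4 = 2).card := by
  have h : evenPartsTwoModFour d = (d.parts.filter fun η => η % 4 = 2).toFinset := by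
    ext η
    simp only [evenPartsTwoModFour, evenParts, Finset.mem_filter, Multiset.mem_toFinset,
      Multiset.mem_filter, Nat.ModEq, Nat.even_iff]
    constructor
    · rintro ⟨⟨h1, h2⟩, h3⟩
      exact ⟨h1, by omega⟩
    · rintro ⟨h1, h2⟩
      exact ⟨⟨h1, by omega⟩, by omega⟩
  rw [countTwoModFour, h, ← Multiset.toFinset_sum_count_eq]
  refine Finset.sum_congr rfl fun η hη => ?_
  rw [Multiset.count_filter_of_pos]
  exact (Multiset.mem_filter.1 (Multiset.mem_toFinset.1 hη)).2

/-- An even number is `0` or `2` modulo `4`, so the sum modulo `4` only sees how many terms are `2`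
modulo `4`. -/
lemma sum_mod_four_of_even (s : Multiset ℕ) (hs : ∀ η ∈ s, Even η) :
    s.sum % 4 = 2 * (s.filter fun η => η % 4 = 2).card % 4 := by
  induction s using Multiset.induction_on with
  | empty => simp
  | cons η s ih =>
    have h1 := ih fun x hx => hs x (Multiset.mem_cons_of_mem hx)
    have h2 := Nat.even_iff.1 (hs η (Multiset.mem_cons_self η s))
    rw [Multiset.sum_cons, Multiset.filter_cons]
    split_ifs with h
    · rw [Multiset.card_add, Multiset.card_singleton]
      omega
    · rw [zero_add]
      omega

lemma two_mul_countTwoModFour_mod_four {m : ℕ} {d : Nat.Partition m}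
    (hd : ¬ (oddParts d).Nonempty) : 2 * countTwoModFour d % 4 = m % 4 := by
  rw [countTwoModFour_eq_card, ← sum_mod_four_of_even, d.parts_sum]
  intro η hη
  by_contra h
  exact hd ⟨η, Finset.mem_filter.2
    ⟨Multiset.mem_toFinset.2 hη, Nat.not_even_iff_odd.1 h⟩⟩

/-- Twice the left side is congruent to `n` modulo `4`. No parity of `n` is needed: for odd `n` the
rational left side is not an integer, and both sides fail. -/
lemma exists_eq_two_mul_iff {c d n p q : ℕ} (hc : 2 * c % 4 = p % 4) (hd : 2 * d % 4 = q % 4) :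
    (∃ k : ℤ, (c : ℚ) + d + ((n : ℚ) - (p + q)) / 2 = 2 * (k : ℚ)) ↔ 4 ∣ n := by
  have h : ∀ k : ℤ, ((c : ℚ) + d + ((n : ℚ) - (p + q)) / 2 = 2 * (k : ℚ)) ↔
      (2 * c + 2 * d + n - p - q : ℤ) = 4 * k := by
    intro k
    rw [← @Int.cast_inj ℚ]
    push_cast
    constructor <;> intro h <;> linarith
  simp only [h]
  constructor
  · rintro ⟨k, hk⟩
    omega
  · intro hn
    exact ⟨(2 * c + 2 * d + n - p - q : ℤ) / 4, by omega⟩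

/-! ### Block data of a matrix and passage to its Jordan form -/

namespace JordanDecomposition

variable {n : ℕ} {A : Matrix (Fin n) (Fin n) ℂ}

lemma oddParts_partition_nonempty_iff (J : JordanDecomposition A) (μ : ℂ) :
    (oddParts (J.partition μ)).Nonempty ↔ ∃ i, J.ev i = μ ∧ Odd (J.sz i) := by
  constructor
  · rintro ⟨η, hη⟩
    obtain ⟨h1, h2⟩ := Finset.mem_filter.1 hη
    have h3 : η ∈ J.blockSizes μ := Multiset.mem_toFinset.1 h1
    obtain ⟨i, hi, rfl⟩ := Multiset.mem_map.1 h3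
    rw [Finset.mem_val] at hi
    exact ⟨i, (Finset.mem_filter.1 hi).2, h2⟩
  · rintro ⟨i, hi, hodd⟩
    refine ⟨J.sz i, Finset.mem_filter.2 ⟨Multiset.mem_toFinset.2 ?_, hodd⟩⟩
    exact Multiset.mem_map.2 ⟨i, Finset.mem_filter.2 ⟨Finset.mem_univ i, hi⟩, rfl⟩

lemma exists_odd_iff (J : JordanDecomposition A) :
    ((oddParts (J.partition 1)).Nonempty ∨ (oddParts (J.partition (-1))).Nonempty) ↔
      ∃ i, J.ev i * J.ev i = 1 ∧ Odd (J.sz i) := by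
  rw [J.oddParts_partition_nonempty_iff, J.oddParts_partition_nonempty_iff, ← exists_or]
  refine exists_congr fun i => ?_
  rw [mul_self_eq_one_iff, or_and_right]

/-- The change of basis to the Jordan form. -/
def toJordanForm (J : JordanDecomposition A) :
    Matrix (Fin n) (Fin n) ℂ ≃* Matrix (Σ i, Fin (J.sz i)) (Σ i, Fin (J.sz i)) ℂ where
  toFun X := (Matrix.reindexAlgEquiv ℂ ℂ J.index).symm (J.S.1 * X * J.S.2)
  invFun Y := J.S.2 * Matrix.reindexAlgEquiv ℂ ℂ J.index Y * J.S.1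
  left_inv X := by
    dsimp only
    rw [AlgEquiv.apply_symm_apply]
    calc J.S.2 * (J.S.1 * X * J.S.2) * J.S.1 = (J.S.2 * J.S.1) * X * (J.S.2 * J.S.1) := by
          simp only [Matrix.mul_assoc]
      _ = X := by rw [J.S.inv_val, Matrix.one_mul, Matrix.mul_one]
  right_inv Y := by
    dsimp only
    rw [AlgEquiv.symm_apply_eq]
    calc J.S.1 * (J.S.2 * Matrix.reindexAlgEquiv ℂ ℂ J.index Y * J.S.1) * J.S.2
        = (J.S.1 * J.S.2) * Matrix.reindexAlgEquiv ℂ ℂ J.index Y * (J.S.1 * J.S.2) := by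
          simp only [Matrix.mul_assoc]
      _ = _ := by rw [J.S.val_inv, Matrix.one_mul, Matrix.mul_one]
  map_mul' X Y := by
    rw [← map_mul]
    congr 1
    calc J.S.1 * (X * Y) * J.S.2 = J.S.1 * X * 1 * Y * J.S.2 := by
          simp only [Matrix.mul_assoc, Matrix.one_mul]
      _ = J.S.1 * X * (J.S.2 * J.S.1) * Y * J.S.2 := by rw [J.S.inv_val]
      _ = _ := by simp only [Matrix.mul_assoc]

lemma toJordanForm_self (J : JordanDecomposition A) :
    J.toJordanForm A = jordanMatrix J.ev J.sz := by
  have h : J.S.1 * A * J.S.2 = Matrix.reindexAlgEquiv ℂ ℂ J.index (jordanMatrix J.ev J.sz) := by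
    rw [Matrix.coe_reindexAlgEquiv, ← J.conj_eq, ← Matrix.coe_units_inv]
    rfl
  change (Matrix.reindexAlgEquiv ℂ ℂ J.index).symm (J.S.1 * A * J.S.2) = _
  rw [h, AlgEquiv.symm_apply_apply]

lemma det_toJordanForm (J : JordanDecomposition A) (X : Matrix (Fin n) (Fin n) ℂ) :
    (J.toJordanForm X).det = X.det := by
  change (Matrix.reindexAlgEquiv ℂ ℂ J.index.symm (J.S.1 * X * J.S.2)).det = _
  rw [Matrix.det_reindexAlgEquiv, Matrix.det_mul, Matrix.det_mul, mul_right_comm,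
    ← Matrix.det_mul, J.S.val_inv, Matrix.det_one, one_mul]

end JordanDecomposition

/-! ### Strong reversibility in terms of one reversing involution -/

/-- This form of reversibility contains no inverse, so it makes sense in the full matrix ring and
can be checked block by block. -/
lemma mul_mul_eq_of_isReversible {G : Type*} [Group G] {g : G} (hg : IsReversible g) :
    ∃ h : G, g * h * g = h := by
  obtain ⟨h, hh⟩ := hg
  refine ⟨h, ?_⟩
  rw [mul_inv_eq_iff_eq_mul] at hh
  rw [mul_assoc, hh, mul_inv_cancel_left]

lemma isStronglyReversible_iff {G : Type*} [Group G] {g : G} :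
    IsStronglyReversible g ↔ ∃ a : G, a * a = 1 ∧ g * a * g = a := by
  constructor
  · rintro ⟨a, b, ha, hb, rfl⟩
    rw [IsInvolution, sq] at ha hb
    refine ⟨a, ha, ?_⟩
    calc a * b * a * (a * b) = a * (b * (a * a) * b) := by group
      _ = a := by rw [ha, mul_one, hb, mul_one]
  · rintro ⟨a, ha, hga⟩
    refine ⟨a, a * g, by rw [IsInvolution, sq, ha], ?_, by rw [← mul_assoc, ha, one_mul]⟩
    rw [IsInvolution, sq, mul_assoc, ← mul_assoc g, hga, ha]

/-- Conjugation and reindexing preserve products and determinants, so `det a = 1` is all that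
remains of the special linear group. -/
lemma isStronglyReversible_iff_jordanMatrix {n : ℕ} {A : Matrix.SpecialLinearGroup (Fin n) ℂ}
    (J : JordanDecomposition (A : Matrix (Fin n) (Fin n) ℂ)) :
    IsStronglyReversible A ↔
      ∃ a : Matrix (Σ i, Fin (J.sz i)) (Σ i, Fin (J.sz i)) ℂ, a * a = 1 ∧
        jordanMatrix J.ev J.sz * a * jordanMatrix J.ev J.sz = a ∧ a.det = 1 := by
  rw [isStronglyReversible_iff, ← J.toJordanForm_self]
  constructor
  · rintro ⟨a, ha, hA⟩
    refine ⟨J.toJordanForm a, ?_, ?_, ?_⟩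
    · rw [← map_mul, ← Matrix.SpecialLinearGroup.coe_mul, ha, Matrix.SpecialLinearGroup.coe_one,
        map_one]
    · rw [← map_mul, ← map_mul, ← Matrix.SpecialLinearGroup.coe_mul,
        ← Matrix.SpecialLinearGroup.coe_mul, hA]
    · rw [J.det_toJordanForm, a.det_coe]
  · rintro ⟨a, ha, hA, hdet⟩
    obtain ⟨a, rfl⟩ := J.toJordanForm.surjective a
    rw [J.det_toJordanForm] at hdet
    rw [← map_mul, ← map_mul, EmbeddingLike.apply_eq_iff_eq] at hA
    rw [← map_mul, ← map_one J.toJordanForm, EmbeddingLike.apply_eq_iff_eq] at ha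
    exact ⟨⟨a, hdet⟩, Subtype.ext ha, Subtype.ext hA⟩

end StrongReversibility

/-! ### Proof of the criterion -/

theorem mainTheorem1 (n : ℕ) (A : Matrix.SpecialLinearGroup (Fin n) ℂ)
    (hA : StrongReversibility.IsReversible A)
    (J : StrongReversibility.JordanDecomposition (A : Matrix (Fin n) (Fin n) ℂ)) :
    StrongReversibility.IsStronglyReversible A ↔
      ((StrongReversibility.oddParts (J.partition 1)).Nonempty ∨
        (StrongReversibility.oddParts (J.partition (-1))).Nonempty) ∨
      ∃ k : ℤ,
        (StrongReversibility.countTwoModFour (J.partition 1) : ℚ) +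
          (StrongReversibility.countTwoModFour (J.partition (-1)) : ℚ) +
          ((n : ℚ) -
            ((StrongReversibility.eigenMult (A : Matrix (Fin n) (Fin n) ℂ) 1 : ℚ) +
              (StrongReversibility.eigenMult (A : Matrix (Fin n) (Fin n) ℂ) (-1) : ℚ))) / 2 =
        2 * (k : ℚ) := by
  open StrongReversibility in
  obtain ⟨h, hu, hh⟩ : ∃ h : Matrix (Σ i, Fin (J.sz i)) (Σ i, Fin (J.sz i)) ℂ, IsUnit h ∧
      jordanMatrix J.ev J.sz * h * jordanMatrix J.ev J.sz = h := by
    obtain ⟨h, hh⟩ := mul_mul_eq_of_isReversible hA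
    refine ⟨J.toJordanForm h, ?_, ?_⟩
    · rw [Matrix.isUnit_iff_isUnit_det, J.det_toJordanForm, h.det_coe]
      exact isUnit_one
    · rw [← J.toJordanForm_self, ← map_mul, ← map_mul, ← Matrix.SpecialLinearGroup.coe_mul,
        ← Matrix.SpecialLinearGroup.coe_mul, hh]
  rw [isStronglyReversible_iff_jordanMatrix J]
  by_cases hodd : (oddParts (J.partition 1)).Nonempty ∨ (oddParts (J.partition (-1))).Nonempty
  · obtain ⟨i, hi, hi'⟩ := J.exists_odd_iff.1 hodd
    exact ⟨fun _ => Or.inl hodd, fun _ => exists_involution_jordanMatrix_det_eq_one hu hh hi hi'⟩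
  have heven : ∀ i, J.ev i * J.ev i = 1 → Even (J.sz i) := fun i hi =>
    Nat.not_odd_iff_even.1 fun hi' => hodd (J.exists_odd_iff.2 ⟨i, hi, hi'⟩)
  -- Trace zero gives `n = 2 * k` and `det a = (-1) ^ k`: the determinant depends only on `n`, not
  -- on the chosen involution.
  have hdet : ∀ a : Matrix (Σ i, Fin (J.sz i)) (Σ i, Fin (J.sz i)) ℂ, a * a = 1 →
      jordanMatrix J.ev J.sz * a * jordanMatrix J.ev J.sz = a → (a.det = 1 ↔ 4 ∣ n) := by
    intro a ha hM
    obtain ⟨k, h1, h2⟩ := det_of_mul_self_eq_one_of_trace_eq_zero ha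
      (trace_eq_zero_of_jordanMatrix_mul_mul heven hM)
    rw [Fintype.card_congr J.index, Fintype.card_fin] at h1
    rw [h2, neg_one_pow_eq_one_iff_even (by norm_num), Nat.even_iff]
    omega
  rw [not_or] at hodd
  rw [or_iff_right (not_or.2 hodd),
    exists_eq_two_mul_iff (two_mul_countTwoModFour_mod_four hodd.1)
      (two_mul_countTwoModFour_mod_four hodd.2)]
  constructor
  · rintro ⟨a, ha, hM, had⟩
    exact (hdet a ha hM).1 had
  · intro hn
    obtain ⟨a, ha, hM, -⟩ := exists_involution_jordanMatrix hu hh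
    exact ⟨a, ha, hM, (hdet a ha hM).2 hn⟩
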